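/- **Theorem 1.1 (2D REP with zero background).** Let $k>0$, $\rho_0\ge 0$ and let $M_0$ be a real $2\times 2$ matrix. Consider, along a particle path, the 2D restricted Euler–Poisson system with zero background, $$M'+M^2=\frac k2\,\rho\, I_{2\times2},\qquad \rho'+\rho\,\operatorname{tr}M=0,\qquad (\rho,M)(0)=(\rho_0,M_0),$$ for a real function $\rho=\rho(t)$ and a real $2\times2$ matrix function $M=M(t)$, $t\ge 0$. Put $d_0=\operatorname{tr}M_0$ and $\Gamma_0=(\operatorname{tr}M_0)^2-4\det M_0$. Let $$S_1=\{(\rho,d,\Gamma):\ \rho\ge 0,\ \Gamma\le 0,\ \text{and } d\ge 0 \text{ if } \rho=0\},$$ $$S_2=\{(\rho,d,\Gamma):\ \rho>0,\ \Gamma>0,\ d\ge g(\rho,\Gamma)\},$$ $$g(\rho,\Gamma)=\operatorname{sgn}(\Gamma-2k\rho)\sqrt{\Gamma-2k\rho+2k\rho\ln\Big(\frac{2k\rho}{\Gamma}\Big)}.$$ 1. Suppose that $\rho_0>0$, or that $\rho_0=0$ and $\Gamma_0=0$. Then the solution exists and is smooth for all $t\ge 0$ if and only if $(\rho_0,d_0,\Gamma_0)\in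 S_1\cup S_2$. If $(\rho_0,d_0,\Gamma_0)\notin S_1\cup S_2$, the solution blows up in finite time: there is $0<T<\infty$ such that it is smooth on $[0,T)$ and $|\rho(t)|+\sum_{i,j}|M_{ij}(t)|\to\infty$ as $t\uparrow T$. 2. Suppose that $\rho_0=0$ (and $\Gamma_0$ is arbitrary). Then the solution exists and is smooth for all $t\ge 0$ if and only if $\Gamma_0<0$, or $\Gamma_0\ge 0$ and $d_0\ge\sqrt{\Gamma_0}$. Otherwise it blows up in finite time, in the same sense. -/

import Mathlib

open scoped ContDiff

namespace REP

/-- The trace `d = tr M`. -/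
def d (M : Matrix (Fin 2) (Fin 2) ℝ) : ℝ := M.trace

/-- The square of the spectral gap, `Γ = (tr M)² - 4 det M`. -/
def Γ (M : Matrix (Fin 2) (Fin 2) ℝ) : ℝ := M.trace ^ 2 - 4 * M.det

/-- `(ρ, M)` is a smooth solution, on the time set `J`, of the 2D restricted Euler-Poisson system
`M' + M² = (k/2)(ρ - c) I`, `ρ' + ρ tr M = 0` with initial data `(ρ₀, M₀)` at time `0`.
Smoothness and the derivative of the matrix function are taken entrywise. The set `J` is meant to
be `[0, ∞)` or `[0, T)`; at the time `0` the derivatives are one-sided. -/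
structure IsSmoothSolution (k c ρ₀ : ℝ) (M₀ : Matrix (Fin 2) (Fin 2) ℝ) (J : Set ℝ)
    (ρ : ℝ → ℝ) (M : ℝ → Matrix (Fin 2) (Fin 2) ℝ) : Prop where
  smooth_ρ : ContDiffOn ℝ ∞ ρ J
  smooth_M : ∀ i j, ContDiffOn ℝ ∞ (fun t => M t i j) J
  eq_M : ∀ t ∈ J, ∀ i j, HasDerivWithinAt (fun s => M s i j)
    ((-(M t ^ 2) + (k / 2 * (ρ t - c)) • (1 : Matrix (Fin 2) (Fin 2) ℝ)) i j) J t
  eq_ρ : ∀ t ∈ J, HasDerivWithinAt ρ (-(ρ t * d (M t))) J t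
  init_ρ : ρ 0 = ρ₀
  init_M : M 0 = M₀

/-- The solution with initial data `(ρ₀, M₀)` exists and is smooth for all times `t ≥ 0`. -/
def SmoothForAllTime (k c ρ₀ : ℝ) (M₀ : Matrix (Fin 2) (Fin 2) ℝ) : Prop :=
  ∃ (ρ : ℝ → ℝ) (M : ℝ → Matrix (Fin 2) (Fin 2) ℝ),
    IsSmoothSolution k c ρ₀ M₀ (Set.Ici 0) ρ M

/-- The solution with initial data `(ρ₀, M₀)` exists up to some time `0 < T < ∞`, at which its
size `|ρ| + ∑ |Mᵢⱼ|` tends to infinity. -/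
def BlowsUpInFiniteTime (k c ρ₀ : ℝ) (M₀ : Matrix (Fin 2) (Fin 2) ℝ) : Prop :=
  ∃ T : ℝ, 0 < T ∧ ∃ (ρ : ℝ → ℝ) (M : ℝ → Matrix (Fin 2) (Fin 2) ℝ),
    IsSmoothSolution k c ρ₀ M₀ (Set.Ico 0 T) ρ M ∧
    Filter.Tendsto (fun t => |ρ t| + ∑ i, ∑ j, |M t i j|) (nhdsWithin T (Set.Iio T)) Filter.atTop

/-- `g(ρ, Γ) = sgn(Γ - 2kρ) √(Γ - 2kρ + 2kρ ln(2kρ/Γ))`, used for `ρ, Γ > 0` only. -/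
noncomputable def g (k ρ Γ : ℝ) : ℝ :=
  Real.sign (Γ - 2 * k * ρ) *
    Real.sqrt (Γ - 2 * k * ρ + 2 * k * ρ * Real.log (2 * k * ρ / Γ))

/-- The set of triples `(ρ, d, Γ)` with `ρ ≥ 0`, `Γ ≤ 0`, and `d ≥ 0` in case `ρ = 0`. -/
def S₁ : Set (ℝ × ℝ × ℝ) :=
  {p | ∃ ρ d Γ : ℝ, p = (ρ, d, Γ) ∧ 0 ≤ ρ ∧ Γ ≤ 0 ∧ (ρ = 0 → 0 ≤ d)}

/-- The set of triples `(ρ, d, Γ)` with `ρ > 0`, `Γ > 0` and `d ≥ g(ρ, Γ)`. -/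
def S₂ (k : ℝ) : Set (ℝ × ℝ × ℝ) :=
  {p | ∃ ρ d Γ : ℝ, p = (ρ, d, Γ) ∧ 0 < ρ ∧ 0 < Γ ∧ g k ρ Γ ≤ d}

end REP

namespace REP

open Set Filter Topology Metric

/-! ### Autonomous ODEs: smoothness, uniqueness, global existence or blow-up -/

section ODE

variable {E : Type*} [NormedAddCommGroup E] [NormedSpace ℝ E]

/-! Put q = exp(∫ tr M / 2). The density, the off-diagonal entries and the difference of the
diagonal entries of M all solve f' = -f tr M, so each is its initial value divided by q², while tr M
= 2q'/q. What remains is q'' = A/q - B/q³ with A = kρ₀/2, B = Γ₀/4, q(0) = 1, q'(0) = p₀ = d₀/2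
(`IsSmoothSolution.exists_radialMotion`), and the question is whether q can reach 0 in finite time.

For A, B > 0 the force has one equilibrium Q = √(B/A), which is unstable, and energy conservation
reads q'² = p₀² - critSq + A logGap(Q²/q²). Above the level p₀² = critSq the motion never turns
back; below it, Q is never crossed; on it, Q is not reached unless the motion rests there forever.
Hence q collapses exactly when p₀ < critSpeed. For A > 0 ≥ B the energy alone keeps q away from 0;
for A = 0, q² is a quadratic polynomial in t.

These are a priori statements about any solution. They become existence statements through the
alternative `exists_global_or_blowup`: a lower bound on q excludes blow-up, and a forced collapse
excludes a global solution. -/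

theorem contDiffOn_of_isIntegralCurveOn {f : E → E} (hf : ContDiff ℝ ∞ f) {J : Set ℝ}
    (hJ : UniqueDiffOn ℝ J) {x : ℝ → E} (hx : IsIntegralCurveOn x (fun _ => f) J) :
    ContDiffOn ℝ ∞ x J := by
  rw [contDiffOn_infty]
  intro n
  -- Bootstrap: if x is C^n then so is x' = f ∘ x, hence x is C^(n+1).
  induction n with
  | zero => exact contDiffOn_zero.2 hx.continuousOn
  | succ n ih =>
    push_cast
    rw [contDiffOn_succ_iff_derivWithin hJ]
    refine ⟨fun t ht => (hx t ht).differentiableWithinAt, by simp, ?_⟩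
    refine ContDiffOn.congr (f := fun t => f (x t)) ?_
      fun t ht => (hx t ht).derivWithin (hJ t ht)
    exact (hf.of_le (by exact_mod_cast le_top)).comp_contDiffOn ih

theorem isIntegralCurveOn_concat {f : E → E} {a b c : ℝ} {x z : ℝ → E} (hab : a ≤ b)
    (hx : IsIntegralCurveOn x (fun _ => f) (Icc a b))
    (hz : IsIntegralCurveOn z (fun _ => f) (Icc b c)) (h : x b = z b) :
    IsIntegralCurveOn (fun t => if t ≤ b then x t else z t) (fun _ => f) (Icc a c) := by
  intro t ht
  have e1 : EqOn (fun t => if t ≤ b then x t else z t) x (Icc a b) := fun s hs => by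
    simp [hs.2]
  have e2 : EqOn (fun t => if t ≤ b then x t else z t) z (Icc b c) := fun s hs => by
    rcases hs.1.eq_or_lt with rfl | h'
    · simp [h]
    · simp [h'.not_ge]
  have d1 : ∀ s ∈ Icc a b, HasDerivWithinAt (fun t => if t ≤ b then x t else z t)
      (f (if s ≤ b then x s else z s)) (Icc a b) s := fun s hs => by
    have := (hx s hs).congr_of_mem e1 hs
    rwa [← e1 hs] at this
  have d2 : ∀ s ∈ Icc b c, HasDerivWithinAt (fun t => if t ≤ b then x t else z t)
      (f (if s ≤ b then x s else z s)) (Icc b c) s := fun s hs => by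
    have := (hz s hs).congr_of_mem e2 hs
    rwa [← e2 hs] at this
  rcases lt_trichotomy t b with hlt | rfl | hgt
  · refine (d1 t ⟨ht.1, hlt.le⟩).mono_of_mem_nhdsWithin ?_
    filter_upwards [self_mem_nhdsWithin, mem_nhdsWithin_of_mem_nhds (Iio_mem_nhds hlt)]
      with s hs hs' using ⟨hs.1, le_of_lt hs'⟩
  · exact ((d1 t ⟨ht.1, le_rfl⟩).union (d2 t ⟨le_rfl, ht.2⟩)).mono
      (Icc_subset_Icc_union_Icc)
  · refine (d2 t ⟨hgt.le, ht.2⟩).mono_of_mem_nhdsWithin ?_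
    filter_upwards [self_mem_nhdsWithin, mem_nhdsWithin_of_mem_nhds (Ioi_mem_nhds hgt)]
      with s hs hs' using ⟨le_of_lt hs', hs.2⟩

variable [FiniteDimensional ℝ E]

/-- The ball of radius R + 1 contains the unit ball around every admissible y, so one Lipschitz
constant and one bound on f serve all of them in Picard–Lindelöf. -/
theorem exists_uniform_time {f : E → E} (hf : ContDiff ℝ 1 f) (R : ℝ) :
    ∃ ε > 0, ∀ y : E, ‖y‖ ≤ R →
      ∃ x : ℝ → E, x 0 = y ∧ IsIntegralCurveOn x (fun _ => f) (Icc 0 ε) := by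
  have := FiniteDimensional.proper ℝ E
  have hc : IsCompact (closedBall (0 : E) (R + 1)) := isCompact_closedBall _ _
  obtain ⟨K, hK⟩ := hf.contDiffOn.exists_lipschitzOnWith one_ne_zero
    (convex_closedBall (0 : E) (R + 1)) hc
  obtain ⟨L, hL⟩ := hc.exists_bound_of_continuousOn hf.continuous.continuousOn
  obtain ⟨M, hM⟩ : ∃ M : NNReal, (M : ℝ) = max L 0 + 1 := ⟨⟨max L 0 + 1, by positivity⟩, rfl⟩
  have hM0 : 0 < (M : ℝ) := by rw [hM]; positivity
  refine ⟨1 / M, by positivity, fun y hy => ?_⟩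
  have hsub : closedBall y 1 ⊆ closedBall (0 : E) (R + 1) :=
    closedBall_subset_closedBall' (by rw [dist_zero_right]; linarith)
  have h0 : (0 : ℝ) ∈ Icc 0 (1 / (M : ℝ)) := ⟨le_rfl, by positivity⟩
  have hpl : IsPicardLindelof (fun _ => f) (⟨0, h0⟩ : Icc (0 : ℝ) (1 / (M : ℝ))) y
      (1 : NNReal) 0 M K := by
    refine IsPicardLindelof.of_time_independent (fun z hz => ?_) (hK.mono hsub) ?_
    · rw [hM]
      exact (hL z (hsub hz)).trans (by linarith [le_max_left L 0])
    · rw [sub_zero, sub_self, max_eq_left h0.2, mul_one_div_cancel hM0.ne']; simp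
  exact hpl.exists_eq_forall_mem_Icc_hasDerivWithinAt₀

theorem isIntegralCurveOn_Icc_unique {f : E → E} (hf : ContDiff ℝ 1 f) {b : ℝ} {x y : ℝ → E}
    (hx : IsIntegralCurveOn x (fun _ => f) (Icc 0 b))
    (hy : IsIntegralCurveOn y (fun _ => f) (Icc 0 b)) (h0 : x 0 = y 0) :
    EqOn x y (Icc 0 b) := by
  have := FiniteDimensional.proper ℝ E
  obtain ⟨R, hR⟩ := isCompact_Icc.exists_bound_of_continuousOn hx.continuousOn
  obtain ⟨R', hR'⟩ := isCompact_Icc.exists_bound_of_continuousOn hy.continuousOn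
  obtain ⟨K, hK⟩ := hf.contDiffOn.exists_lipschitzOnWith one_ne_zero
    (convex_closedBall (0 : E) (max R R')) (isCompact_closedBall _ _)
  have key : ∀ {z : ℝ → E}, IsIntegralCurveOn z (fun _ => f) (Icc 0 b) →
      ∀ t ∈ Ico 0 b, HasDerivWithinAt z (f (z t)) (Ici t) t := fun hz t ht =>
    (hz t (Ico_subset_Icc_self ht)).mono_of_mem_nhdsWithin (Icc_mem_nhdsGE_of_mem ht)
  refine ODE_solution_unique_of_mem_Icc_right (v := fun _ => f)
    (s := fun _ => closedBall 0 (max R R')) (K := K) (fun _ _ => hK) hx.continuousOn (key hx)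
    (fun t ht => ?_) hy.continuousOn (key hy) (fun t ht => ?_) h0
  · simpa using Or.inl (hR t (Ico_subset_Icc_self ht))
  · simpa using Or.inr (hR' t (Ico_subset_Icc_self ht))

/-- An autonomous `C¹` system has, for every initial value, either a global forward solution or a
forward solution whose norm tends to infinity at a finite time. -/
theorem exists_global_or_blowup {f : E → E} (hf : ContDiff ℝ 1 f) (x₀ : E) :
    (∃ x : ℝ → E, x 0 = x₀ ∧ IsIntegralCurveOn x (fun _ => f) (Ici 0)) ∨
    ∃ T : ℝ, 0 < T ∧ ∃ x : ℝ → E, x 0 = x₀ ∧ IsIntegralCurveOn x (fun _ => f) (Ico 0 T) ∧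
      Tendsto (fun t => ‖x t‖) (𝓝[<] T) atTop := by
  classical
  set S : Set ℝ := {T | 0 < T ∧ ∃ x : ℝ → E, x 0 = x₀ ∧
    IsIntegralCurveOn x (fun _ => f) (Icc 0 T)} with hS
  obtain ⟨T₀, hT₀⟩ : S.Nonempty := by
    obtain ⟨ε, hε, h⟩ := exists_uniform_time hf ‖x₀‖
    exact ⟨ε, hε, h x₀ le_rfl⟩
  have hsol : ∀ T ∈ S, ∃ x : ℝ → E, x 0 = x₀ ∧ IsIntegralCurveOn x (fun _ => f) (Icc 0 T) :=
    fun T hT => hT.2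
  choose! sol sol0 solc using hsol
  -- Glues the local solutions; by uniqueness the chosen T does not matter.
  set X : ℝ → E := fun t => if h : ∃ T ∈ S, t ≤ T then sol h.choose t else 0 with hX
  have hXe : ∀ T ∈ S, EqOn X (sol T) (Icc 0 T) := by
    intro T hT t ht
    have h : ∃ T ∈ S, t ≤ T := ⟨T, hT, ht.2⟩
    simp only [hX, dif_pos h]
    have hc := h.choose_spec
    exact isIntegralCurveOn_Icc_unique hf ((solc _ hc.1).mono (Icc_subset_Icc_right hc.2))
      ((solc T hT).mono (Icc_subset_Icc_right ht.2)) (by rw [sol0 _ hc.1, sol0 T hT])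
      ⟨ht.1, le_rfl⟩
  have hXc : ∀ T ∈ S, IsIntegralCurveOn X (fun _ => f) (Icc 0 T) := by
    intro T hT t ht
    have := (solc T hT t ht).congr_of_mem (hXe T hT) ht
    rwa [← hXe T hT ht] at this
  have hX0 : X 0 = x₀ := by rw [hXe T₀ hT₀ ⟨le_rfl, hT₀.1.le⟩, sol0 T₀ hT₀]
  have hloc : ∀ J : Set ℝ, J ⊆ Ici 0 → (∀ t ∈ J, ∃ T ∈ S, t < T) →
      IsIntegralCurveOn X (fun _ => f) J := by
    intro J hJ h t ht
    obtain ⟨T, hT, htT⟩ := h t ht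
    refine (hXc T hT t ⟨hJ ht, htT.le⟩).mono_of_mem_nhdsWithin ?_
    filter_upwards [self_mem_nhdsWithin, mem_nhdsWithin_of_mem_nhds (Iio_mem_nhds htT)]
      with s hs hs' using ⟨hJ hs, le_of_lt hs'⟩
  by_cases hb : BddAbove S
  · right
    have hT₀' : T₀ ≤ sSup S := le_csSup hb hT₀
    refine ⟨sSup S, hT₀.1.trans_le hT₀', X, hX0, ?_, ?_⟩
    · exact hloc _ (fun t ht => ht.1) fun t ht => exists_lt_of_lt_csSup ⟨T₀, hT₀⟩ ht.2
    · by_contra hne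
      rw [Filter.tendsto_atTop] at hne
      push Not at hne
      obtain ⟨R, hR⟩ := hne
      -- If the norm does not tend to infinity, it is below R at times arbitrarily close to `sSup
      -- S`; restarting less than ε before the supremum continues the solution past it.
      obtain ⟨ε, hε, hu⟩ := exists_uniform_time hf R
      have hpos : max 0 (sSup S - ε) < sSup S := max_lt (hT₀.1.trans_le hT₀') (by linarith)
      obtain ⟨t, ht, htm⟩ := (hR.and_eventually (Ioo_mem_nhdsLT hpos)).exists
      obtain ⟨h0t, hεt⟩ := max_lt_iff.1 htm.1
      obtain ⟨z, hz0, hz⟩ := hu (X t) ht.le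
      have hz' : IsIntegralCurveOn (fun s => z (s - t)) (fun _ => f) (Icc t (t + ε)) := by
        have := hz.comp_sub t
        refine this.mono fun s hs => ?_
        rw [mem_vadd_set_iff_neg_vadd_mem, vadd_eq_add]
        exact ⟨by linarith [hs.1], by linarith [hs.2]⟩
      obtain ⟨T, hT, htT⟩ := exists_lt_of_lt_csSup ⟨T₀, hT₀⟩ htm.2
      have hcc := isIntegralCurveOn_concat h0t.le
        ((hXc T hT).mono (Icc_subset_Icc_right htT.le)) hz' (by simp [hz0])
      have hmem : t + ε ∈ S := ⟨by linarith, _, by simp [h0t.le, hX0], hcc⟩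
      linarith [le_csSup hb hmem]
  · left
    refine ⟨X, hX0, hloc _ subset_rfl fun t _ => ?_⟩
    rw [not_bddAbove_iff] at hb
    exact hb t

end ODE

end REP

namespace REP

open Set Filter Topology

/-! ### Comparison and Grönwall arguments on a compact interval -/

section Calculus

theorem monotoneOn_Icc_of_deriv_nonneg {a b : ℝ} {f f' : ℝ → ℝ}
    (hf : ∀ t ∈ Icc a b, HasDerivWithinAt f (f' t) (Icc a b) t) (h : ∀ t ∈ Icc a b, 0 ≤ f' t) :
    MonotoneOn f (Icc a b) :=
  monotoneOn_of_hasDerivWithinAt_nonneg (convex_Icc a b) (HasDerivWithinAt.continuousOn hf)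
    (fun t ht => (hf t (interior_subset ht)).mono interior_subset)
    fun t ht => h t (interior_subset ht)

theorem le_add_mul_of_deriv_le {b c : ℝ} {f f' : ℝ → ℝ}
    (hf : ∀ t ∈ Icc 0 b, HasDerivWithinAt f (f' t) (Icc 0 b) t)
    (h : ∀ t ∈ Icc 0 b, f' t ≤ c) {t : ℝ} (ht : t ∈ Icc 0 b) : f t ≤ f 0 + c * t := by
  have hm := monotoneOn_Icc_of_deriv_nonneg (f := fun s => c * s - f s) (f' := fun s => c - f' s)
    (fun s hs => by
      have := ((hasDerivWithinAt_id s (Icc 0 b)).const_mul c).sub (hf s hs)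
      rw [mul_one] at this
      exact this)
    (fun s hs => sub_nonneg.2 (h s hs)) ⟨le_rfl, ht.1.trans ht.2⟩ ht ht.1
  simp only [mul_zero] at hm
  linarith

theorem add_mul_le_of_le_deriv {b c : ℝ} {f f' : ℝ → ℝ}
    (hf : ∀ t ∈ Icc 0 b, HasDerivWithinAt f (f' t) (Icc 0 b) t)
    (h : ∀ t ∈ Icc 0 b, c ≤ f' t) {t : ℝ} (ht : t ∈ Icc 0 b) : f 0 + c * t ≤ f t := by
  have := le_add_mul_of_deriv_le (f := fun s => -f s) (c := -c) (fun s hs => (hf s hs).neg)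
    (fun s hs => neg_le_neg (h s hs)) ht
  linarith

theorem eq_init_of_deriv_eq_zero {b : ℝ} {f f' : ℝ → ℝ}
    (hf : ∀ t ∈ Icc 0 b, HasDerivWithinAt f (f' t) (Icc 0 b) t)
    (h : ∀ t ∈ Icc 0 b, f' t = 0) {t : ℝ} (ht : t ∈ Icc 0 b) : f t = f 0 := by
  have h1 := le_add_mul_of_deriv_le hf (fun s hs => (h s hs).le) ht
  have h2 := add_mul_le_of_le_deriv hf (fun s hs => (h s hs).ge) ht
  linarith

theorem lt_of_ne_of_lt_init {b c : ℝ} {f : ℝ → ℝ} (hf : ContinuousOn f (Icc 0 b))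
    (hne : ∀ t ∈ Icc 0 b, f t ≠ c) (h0 : c < f 0) {t : ℝ} (ht : t ∈ Icc 0 b) : c < f t := by
  by_contra! hle
  obtain ⟨s, hs, he⟩ := intermediate_value_Icc' ht.1 (hf.mono (Icc_subset_Icc_right ht.2))
    ⟨hle, h0.le⟩
  exact hne s ⟨hs.1, hs.2.trans ht.2⟩ he

theorem gt_of_ne_of_init_lt {b c : ℝ} {f : ℝ → ℝ} (hf : ContinuousOn f (Icc 0 b))
    (hne : ∀ t ∈ Icc 0 b, f t ≠ c) (h0 : f 0 < c) {t : ℝ} (ht : t ∈ Icc 0 b) : f t < c := by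
  have := lt_of_ne_of_lt_init (c := -c) hf.neg (fun s hs h => hne s hs (neg_injective h))
    (neg_lt_neg h0) ht
  simpa using this

/-- A function satisfying `|u'| ≤ L u` that vanishes at one point vanishes identically. -/
theorem eq_zero_of_abs_deriv_le_mul {a b L : ℝ} {u u' : ℝ → ℝ}
    (hu : ∀ t ∈ Icc a b, HasDerivWithinAt u (u' t) (Icc a b) t) (h0 : ∀ t ∈ Icc a b, 0 ≤ u t)
    (hL : ∀ t ∈ Icc a b, |u' t| ≤ L * u t) {s : ℝ} (hs : s ∈ Icc a b) (hus : u s = 0)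
    {t : ℝ} (ht : t ∈ Icc a b) : u t = 0 := by
  have hexp : ∀ c r : ℝ, HasDerivWithinAt (fun t => Real.exp (c * t)) (Real.exp (c * r) * c)
      (Icc a b) r := fun c r => by
    simpa using ((hasDerivAt_id r).const_mul c).exp.hasDerivWithinAt (s := Icc a b)
  refine le_antisymm ?_ (h0 t ht)
  -- Backwards in time u·exp(Lt) is monotone, forwards u·exp(-Lt) is antitone.
  rcases le_total t s with hts | hts
  · have hm := monotoneOn_Icc_of_deriv_nonneg (fun r hr => (hu r hr).mul (hexp L r))
      (fun r hr => ?_) ht hs hts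
    · simp only [Pi.mul_apply, hus, zero_mul] at hm
      exact nonpos_of_mul_nonpos_left hm (Real.exp_pos _)
    · have : 0 ≤ (u' r + L * u r) * Real.exp (L * r) :=
        mul_nonneg (by linarith [neg_abs_le (u' r), hL r hr]) (Real.exp_pos _).le
      linarith
  · have hm := monotoneOn_Icc_of_deriv_nonneg (fun r hr => ((hu r hr).mul (hexp (-L) r)).neg)
      (fun r hr => ?_) hs ht hts
    · simp only [Pi.neg_apply, Pi.mul_apply, hus, zero_mul, neg_zero, Left.nonneg_neg_iff] at hm
      exact nonpos_of_mul_nonpos_left hm (Real.exp_pos _)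
    · have : 0 ≤ (L * u r - u' r) * Real.exp (-L * r) :=
        mul_nonneg (by linarith [le_abs_self (u' r), hL r hr]) (Real.exp_pos _).le
      linarith

end Calculus

/-! ### The radial motion and its energy -/

/-- One-dimensional motion `q'' = A / q - B / q ^ 3` with `q > 0` on `[0, b]`, `q 0 = 1`,
`q' 0 = p₀`. -/
structure RadialMotion (A B p₀ b : ℝ) (q p : ℝ → ℝ) : Prop where
  pos : ∀ t ∈ Icc 0 b, 0 < q t
  deriv_q : ∀ t ∈ Icc 0 b, HasDerivWithinAt q (p t) (Icc 0 b) t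
  deriv_p : ∀ t ∈ Icc 0 b, HasDerivWithinAt p (A / q t - B / q t ^ 3) (Icc 0 b) t
  init_q : q 0 = 1
  init_p : p 0 = p₀

/-- The square of the critical initial speed. -/
noncomputable def critSq (A B : ℝ) : ℝ := B - A + A * Real.log (A / B)

/-- The critical initial speed, with the sign for which the motion tends to the equilibrium. -/
noncomputable def critSpeed (A B : ℝ) : ℝ := Real.sign (B - A) * √(critSq A B)

/-- `x - 1 - log x`, the nonnegative convex function vanishing at `1` only. -/
noncomputable def logGap (x : ℝ) : ℝ := x - 1 - Real.log x

theorem logGap_nonneg {x : ℝ} (hx : 0 < x) : 0 ≤ logGap x := by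
  unfold logGap; linarith [Real.log_le_sub_one_of_pos hx]

theorem logGap_pos {x : ℝ} (hx : 0 < x) (h1 : x ≠ 1) : 0 < logGap x := by
  unfold logGap; linarith [Real.log_lt_sub_one_of_pos hx h1]

theorem critSq_eq {A B : ℝ} (hA : 0 < A) (hB : 0 < B) : critSq A B = A * logGap (B / A) := by
  unfold critSq logGap
  rw [Real.log_div hA.ne' hB.ne', Real.log_div hB.ne' hA.ne']
  field_simp
  ring

namespace RadialMotion

variable {A B p₀ b : ℝ} {q p : ℝ → ℝ}

theorem continuousOn_q (h : RadialMotion A B p₀ b q p) : ContinuousOn q (Icc 0 b) :=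
  HasDerivWithinAt.continuousOn h.deriv_q

theorem continuousOn_p (h : RadialMotion A B p₀ b q p) : ContinuousOn p (Icc 0 b) :=
  HasDerivWithinAt.continuousOn h.deriv_p

theorem energy (h : RadialMotion A B p₀ b q p) {t : ℝ} (ht : t ∈ Icc 0 b) :
    p t ^ 2 = p₀ ^ 2 - B + 2 * A * Real.log (q t) + B / q t ^ 2 := by
  have := eq_init_of_deriv_eq_zero (b := b)
    (f := fun s => p s ^ 2 - 2 * A * Real.log (q s) - B * (q s ^ 2)⁻¹)
    (fun s hs => (((h.deriv_p s hs).pow 2).sub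
      (((h.deriv_q s hs).log (h.pos s hs).ne').const_mul (2 * A))).sub
      ((((h.deriv_q s hs).pow 2).inv (pow_ne_zero 2 (h.pos s hs).ne')).const_mul B))
    (fun s hs => ?_) ht
  · simp only [h.init_q, h.init_p, Real.log_one] at this
    rw [div_eq_mul_inv]
    linarith
  · have := (h.pos s hs).ne'
    simp
    field_simp
    ring

/-- Centres the energy at the equilibrium, where the `logGap` term vanishes: p₀² - critSq is the
squared speed the motion would have there. -/
theorem energy_eq_logGap (hA : 0 < A) (hB : 0 < B) (h : RadialMotion A B p₀ b q p) {t : ℝ}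
    (ht : t ∈ Icc 0 b) :
    p t ^ 2 = p₀ ^ 2 - critSq A B + A * logGap (B / (A * q t ^ 2)) := by
  have hq := h.pos t ht
  rw [h.energy ht, critSq, logGap, Real.log_div hA.ne' hB.ne',
    Real.log_div hB.ne' (by positivity), Real.log_mul hA.ne' (by positivity), Real.log_pow]
  push_cast
  field_simp
  ring

theorem crit_le_energy (hA : 0 < A) (hB : 0 < B) (h : RadialMotion A B p₀ b q p) {t : ℝ}
    (ht : t ∈ Icc 0 b) : p₀ ^ 2 - critSq A B ≤ p t ^ 2 := by
  have hq := h.pos t ht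
  rw [h.energy_eq_logGap hA hB ht]
  have := mul_nonneg hA.le (logGap_nonneg (x := B / (A * q t ^ 2)) (by positivity))
  linarith

/-- A motion that is at rest at the equilibrium at some time is there at all times. -/
theorem eq_of_rest (hA : 0 < A) {Q : ℝ} (hQ : 0 < Q) (hQB : A * Q ^ 2 = B)
    (h : RadialMotion A B p₀ b q p) {s : ℝ} (hs : s ∈ Icc 0 b) (hq : q s = Q) (hp : p s = 0)
    {t : ℝ} (ht : t ∈ Icc 0 b) : q t = Q ∧ p t = 0 := by
  obtain ⟨K, hK⟩ := isCompact_Icc.exists_bound_of_continuousOn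
    (f := fun t => 1 + A * (q t + Q) / q t ^ 3) (s := Icc 0 b)
    (continuousOn_const.add ((continuousOn_const.mul (h.continuousOn_q.add continuousOn_const)).div
      (h.continuousOn_q.pow 3) fun r hr => pow_ne_zero 3 (h.pos r hr).ne'))
  have hu := eq_zero_of_abs_deriv_le_mul (L := K) (u := fun t => (q t - Q) ^ 2 + p t ^ 2)
    (fun r hr => (((h.deriv_q r hr).sub_const Q).pow 2).add ((h.deriv_p r hr).pow 2))
    (fun r _ => by positivity) (fun r hr => ?_) hs (by simp [hq, hp]) ht
  · constructor <;> nlinarith [sq_nonneg (q t - Q), sq_nonneg (p t)]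
  · have hr0 := h.pos r hr
    -- The force is (q - Q)κ, so the derivative of (q - Q)² + p² is 2(q - Q)p(1 + κ), controlled by
    -- 2|ab| ≤ a² + b².
    have e : A / q r - B / q r ^ 3 = (q r - Q) * (A * (q r + Q) / q r ^ 3) := by
      rw [← hQB]; field_simp; ring
    have hk := hK r hr
    set κ := A * (q r + Q) / q r ^ 3
    have hκ : 0 ≤ κ := by positivity
    rw [Real.norm_eq_abs, abs_of_nonneg (by positivity)] at hk
    simp only [e]
    have e2 : (2 : ℕ) * (q r - Q) ^ (2 - 1) * p r + (2 : ℕ) * p r ^ (2 - 1) * ((q r - Q) * κ)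
        = (2 * (q r - Q) * p r) * (1 + κ) := by norm_num; ring
    rw [e2, abs_mul, abs_of_nonneg (by positivity : 0 ≤ 1 + κ), mul_comm]
    refine mul_le_mul hk ?_ (abs_nonneg _) (by linarith)
    rw [abs_le]
    constructor <;> nlinarith [sq_nonneg (q r - Q + p r), sq_nonneg (q r - Q - p r)]

end RadialMotion

end REP

namespace REP

open Set Filter Topology

/-! ### The critical speed as threshold, for A, B > 0 -/

theorem critSq_nonneg {A B : ℝ} (hA : 0 < A) (hB : 0 < B) : 0 ≤ critSq A B := by
  rw [critSq_eq hA hB]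
  exact mul_nonneg hA.le (logGap_nonneg (by positivity))

theorem critSq_pos {A B : ℝ} (hA : 0 < A) (hB : 0 < B) (h : A ≠ B) : 0 < critSq A B := by
  rw [critSq_eq hA hB]
  refine mul_pos hA (logGap_pos (by positivity) fun h1 => h ?_)
  rw [div_eq_one_iff_eq hA.ne'] at h1
  exact h1.symm

theorem critSpeed_of_lt {A B : ℝ} (h : A < B) : critSpeed A B = √(critSq A B) := by
  rw [critSpeed, Real.sign_of_pos (sub_pos.2 h), one_mul]

theorem critSpeed_of_gt {A B : ℝ} (h : B < A) : critSpeed A B = -√(critSq A B) := by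
  rw [critSpeed, Real.sign_of_neg (sub_neg.2 h), neg_one_mul]

theorem critSpeed_self (A : ℝ) : critSpeed A A = 0 := by
  rw [critSpeed, sub_self, Real.sign_zero, zero_mul]

theorem critSpeed_sq {A B : ℝ} (hA : 0 < A) (hB : 0 < B) : critSpeed A B ^ 2 = critSq A B := by
  rcases lt_trichotomy A B with h | rfl | h
  · rw [critSpeed_of_lt h, Real.sq_sqrt (critSq_nonneg hA hB)]
  · rw [critSpeed_self, critSq, div_self hA.ne', Real.log_one]; ring
  · rw [critSpeed_of_gt h, neg_sq, Real.sq_sqrt (critSq_nonneg hA hB)]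

namespace RadialMotion

variable {A B p₀ b : ℝ} {q p : ℝ → ℝ}

theorem zero_mem_Icc {t : ℝ} (ht : t ∈ Icc 0 b) :
    (0 : ℝ) ∈ Icc 0 b := ⟨le_rfl, ht.1.trans ht.2⟩

theorem one_le_of_speed_pos (h : RadialMotion A B p₀ b q p) (h0 : 0 < p₀)
    (hne : ∀ t ∈ Icc 0 b, p t ≠ 0) {t : ℝ} (ht : t ∈ Icc 0 b) : 1 ≤ q t := by
  have := add_mul_le_of_le_deriv (c := 0) h.deriv_q (fun s hs =>
    (lt_of_ne_of_lt_init h.continuousOn_p hne (by rw [h.init_p]; exact h0) hs).le) ht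
  rw [h.init_q] at this
  linarith

theorem speed_neg (h : RadialMotion A B p₀ b q p) (h0 : p₀ < 0)
    (hne : ∀ t ∈ Icc 0 b, p t ≠ 0) {t : ℝ} (ht : t ∈ Icc 0 b) : p t < 0 :=
  gt_of_ne_of_init_lt h.continuousOn_p hne (by rw [h.init_p]; exact h0) ht

theorem le_one_of_speed_neg (h : RadialMotion A B p₀ b q p) (h0 : p₀ < 0)
    (hne : ∀ t ∈ Icc 0 b, p t ≠ 0) {t : ℝ} (ht : t ∈ Icc 0 b) : q t ≤ 1 := by
  have := le_add_mul_of_deriv_le (c := 0) h.deriv_q (fun s hs => (h.speed_neg h0 hne hs).le) ht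
  rw [h.init_q] at this
  linarith

theorem speed_ne_zero_of_supercritical (hA : 0 < A) (hB : 0 < B) (h : RadialMotion A B p₀ b q p)
    (hp : critSq A B < p₀ ^ 2) {t : ℝ} (ht : t ∈ Icc 0 b) : p t ≠ 0 := by
  intro h0
  have := h.crit_le_energy hA hB ht
  rw [h0] at this
  nlinarith

theorem equilibrium_sq (hA : 0 < A) (hB : 0 < B) : A * √(B / A) ^ 2 = B := by
  rw [Real.sq_sqrt (by positivity)]
  field_simp

theorem ne_equilibrium_of_subcritical (hA : 0 < A) (hB : 0 < B) (h : RadialMotion A B p₀ b q p)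
    (hp : p₀ ^ 2 < critSq A B) {t : ℝ} (ht : t ∈ Icc 0 b) : q t ≠ √(B / A) := by
  intro h0
  have := h.energy_eq_logGap hA hB ht
  rw [h0, equilibrium_sq hA hB, div_self hB.ne'] at this
  simp only [logGap, Real.log_one] at this
  nlinarith [sq_nonneg (p t)]

/-- At the critical level the equilibrium could only be met at rest; by `eq_of_rest` the motion
would then have started there, but q(0) = 1 ≠ √(B/A). -/
theorem ne_equilibrium_of_critical (hA : 0 < A) (hB : 0 < B) (hAB : A ≠ B)
    (h : RadialMotion A B p₀ b q p) (hp : p₀ ^ 2 = critSq A B) {t : ℝ} (ht : t ∈ Icc 0 b) :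
    q t ≠ √(B / A) := by
  intro h0
  have h1 := h.energy_eq_logGap hA hB ht
  rw [h0, equilibrium_sq hA hB, div_self hB.ne', hp] at h1
  simp only [logGap, Real.log_one] at h1
  have h2 : p t = 0 := by
    have : p t ^ 2 = 0 := by linarith
    exact pow_eq_zero_iff two_ne_zero |>.1 this
  have h3 := (h.eq_of_rest hA (by positivity) (equilibrium_sq hA hB) ht h0 h2 (zero_mem_Icc ht)).1
  have h4 := equilibrium_sq hA hB
  rw [← h3, h.init_q] at h4
  exact hAB (by linarith)

theorem speed_ne_zero_of_critical (hA : 0 < A) (hB : 0 < B) (hAB : A ≠ B)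
    (h : RadialMotion A B p₀ b q p) (hp : p₀ ^ 2 = critSq A B) {t : ℝ} (ht : t ∈ Icc 0 b) :
    p t ≠ 0 := by
  intro h0
  have hq := h.pos t ht
  have h1 := h.energy_eq_logGap hA hB ht
  have h2 : 0 < logGap (B / (A * q t ^ 2)) := by
    refine logGap_pos (by positivity) fun h2 => ?_
    rw [div_eq_one_iff_eq (by positivity)] at h2
    refine h.ne_equilibrium_of_critical hA hB hAB hp ht ?_
    rw [h2, mul_div_cancel_left₀ _ hA.ne', Real.sqrt_sq hq.le]
  have := mul_pos hA h2
  rw [h0, hp] at h1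
  linarith

theorem equilibrium_lt_one (hA : 0 < A) (hAB : B < A) : √(B / A) < 1 := by
  rw [Real.sqrt_lt' one_pos, one_pow, div_lt_one hA]
  exact hAB

theorem one_lt_equilibrium (hA : 0 < A) (hAB : A < B) : 1 < √(B / A) := by
  rw [Real.lt_sqrt zero_le_one, one_pow, one_lt_div hA]
  exact hAB

/-- Either the motion goes outward without turning, so q ≥ 1; or it starts outside the equilibrium
and cannot cross it; or it rests at it. -/
theorem min_le_of_critSpeed_le (hA : 0 < A) (hB : 0 < B) (h : RadialMotion A B p₀ b q p)
    (hp : critSpeed A B ≤ p₀) {t : ℝ} (ht : t ∈ Icc 0 b) : min 1 √(B / A) ≤ q t := by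
  have hs := critSpeed_sq hA hB
  have above : B < A → (∀ s ∈ Icc 0 b, q s ≠ √(B / A)) → min 1 √(B / A) ≤ q t := fun hAB hne =>
    (min_le_right _ _).trans (lt_of_ne_of_lt_init h.continuousOn_q hne
      (by rw [h.init_q]; exact equilibrium_lt_one hA hAB) ht).le
  rcases lt_trichotomy (p₀ ^ 2) (critSq A B) with hlt | heq | hgt
  · have hAB : B < A := by
      by_contra! hAB
      have h0 : 0 ≤ critSpeed A B := by
        rcases hAB.lt_or_eq with h1 | rfl
        · rw [critSpeed_of_lt h1]; positivity
        · rw [critSpeed_self]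
      nlinarith
    exact above hAB fun s hs => h.ne_equilibrium_of_subcritical hA hB hlt hs
  · by_cases hAB : A = B
    · subst hAB
      rw [← hs, critSpeed_self, zero_pow two_ne_zero] at heq
      have h0 : p₀ = 0 := pow_eq_zero_iff two_ne_zero |>.1 heq
      have := (h.eq_of_rest hA one_pos (by ring) (zero_mem_Icc ht) h.init_q
        (h.init_p.trans h0) ht).1
      rw [this]
      exact min_le_left _ _
    · rcases lt_trichotomy p₀ 0 with h0 | h0 | h0
      · have hBA : B < A := by
          by_contra! h1
          rw [critSpeed_of_lt (lt_of_le_of_ne h1 hAB)] at hp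
          linarith [Real.sqrt_nonneg (critSq A B)]
        exact above hBA fun s hs => h.ne_equilibrium_of_critical hA hB hAB heq hs
      · have := critSq_pos hA hB hAB
        rw [← heq, h0] at this
        norm_num at this
      · exact (min_le_left _ _).trans (h.one_le_of_speed_pos h0
          (fun s hs => h.speed_ne_zero_of_critical hA hB hAB heq hs) ht)
  · have h0 : 0 < p₀ := by
      by_contra! h0
      nlinarith
    exact (min_le_left _ _).trans (h.one_le_of_speed_pos h0
      (fun s hs => h.speed_ne_zero_of_supercritical hA hB hgt hs) ht)

/-- The inward speed never drops below c, so q would reach 0 by time 1/c. -/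
theorem not_supercritical_inward (hA : 0 < A) (hB : 0 < B) (h0 : p₀ < 0)
    (hp : critSq A B < p₀ ^ 2) : ∃ b, ∀ q p, ¬ RadialMotion A B p₀ b q p := by
  set c := √(p₀ ^ 2 - critSq A B) with hc
  have hcpos : 0 < c := Real.sqrt_pos.2 (by linarith)
  refine ⟨1 / c, fun q p h => ?_⟩
  have hmem : 1 / c ∈ Icc 0 (1 / c) := ⟨by positivity, le_rfl⟩
  have hle := le_add_mul_of_deriv_le (c := -c) h.deriv_q (fun s hs => ?_) hmem
  · have := h.pos _ hmem
    rw [h.init_q, neg_mul, mul_one_div_cancel hcpos.ne'] at hle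
    linarith
  · have h1 := h.speed_neg h0 (fun s hs => h.speed_ne_zero_of_supercritical hA hB hp hs) hs
    have h2 : c ≤ |p s| := by
      rw [← Real.sqrt_sq_eq_abs]
      exact Real.sqrt_le_sqrt (h.crit_le_energy hA hB hs)
    rw [abs_of_neg h1] at h2
    linarith

/-- While q ≤ 1 < √(B/A) the force points inward, so the inward speed stays at least -p₀. -/
theorem not_critical_inward (hA : 0 < A) (hAB : A < B) (h0 : p₀ < 0)
    (hp : p₀ ^ 2 = critSq A B) : ∃ b, ∀ q p, ¬ RadialMotion A B p₀ b q p := by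
  have hB := hA.trans hAB
  refine ⟨1 / -p₀, fun q p h => ?_⟩
  have hpos : 0 < -p₀ := by linarith
  have hmem : 1 / -p₀ ∈ Icc 0 (1 / -p₀) := ⟨by positivity, le_rfl⟩
  have hne : ∀ s ∈ Icc 0 (1 / -p₀), p s ≠ 0 := fun s hs =>
    h.speed_ne_zero_of_critical hA hB hAB.ne hp hs
  have hle := le_add_mul_of_deriv_le (c := p₀) h.deriv_q (fun s hs => ?_) hmem
  · have := h.pos _ hmem
    have e : p₀ * (1 / -p₀) = -1 := by
      rw [one_div, inv_neg, mul_neg, mul_inv_cancel₀ h0.ne]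
    rw [h.init_q, e] at hle
    linarith
  · have := le_add_mul_of_deriv_le (c := 0) h.deriv_p (fun r hr => ?_) hs
    · rw [h.init_p] at this; linarith
    · have h1 := h.le_one_of_speed_neg h0 hne hr
      have h2 := h.pos r hr
      have e : A / q r - B / q r ^ 3 = (A * q r ^ 2 - B) / q r ^ 3 := by field_simp
      rw [e]
      refine div_nonpos_of_nonpos_of_nonneg ?_ (by positivity)
      have : q r ^ 2 ≤ 1 := by nlinarith
      nlinarith

/-- Even if it first moves outward, the motion is trapped below the equilibrium. The energy deficit
keeps it a definite distance away, which gives an inward acceleration of at least c. -/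
theorem not_subcritical_below (hA : 0 < A) (hAB : A < B) (hp : p₀ ^ 2 < critSq A B) :
    ∃ b, ∀ q p, ¬ RadialMotion A B p₀ b q p := by
  have hB := hA.trans hAB
  have hQ : 0 < √(B / A) := by positivity
  set η := (critSq A B - p₀ ^ 2) / A with hη
  have hηpos : 0 < η := div_pos (by linarith) hA
  set c := A / √(B / A) * η with hc
  have hcpos : 0 < c := by positivity
  -- Large enough that the comparison parabola 1 + p₀b - cb²/2 is negative.
  set b := 2 * (|p₀| + 1) / c + 1 with hb
  have hb1 : 1 ≤ b := by
    have : 0 ≤ 2 * (|p₀| + 1) / c := by positivity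
    linarith
  refine ⟨b, fun q p h => ?_⟩
  have hmem : b ∈ Icc 0 b := ⟨by linarith, le_rfl⟩
  have hacc : ∀ s ∈ Icc 0 b, A / q s - B / q s ^ 3 ≤ -c := fun s hs => by
    have hq := h.pos s hs
    have hlt : q s < √(B / A) := gt_of_ne_of_init_lt h.continuousOn_q
      (fun r hr => h.ne_equilibrium_of_subcritical hA hB hp hr)
      (by rw [h.init_q]; exact one_lt_equilibrium hA hAB) hs
    set x := B / (A * q s ^ 2) with hx
    have hx1 : 1 ≤ x := by
      rw [hx, one_le_div (by positivity)]
      have := (Real.lt_sqrt hq.le).1 hlt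
      rw [lt_div_iff₀ hA] at this
      linarith
    have he := h.energy_eq_logGap hA hB hs
    have h1 : η ≤ logGap x := by
      rw [hη, div_le_iff₀ hA]
      nlinarith [sq_nonneg (p s)]
    have h2 : η ≤ x - 1 := by
      have := Real.log_nonneg hx1
      unfold logGap at h1
      linarith
    have e : A / q s - B / q s ^ 3 = -(A / q s * (x - 1)) := by
      rw [hx]; field_simp; ring
    rw [e, hc]
    refine neg_le_neg (mul_le_mul ?_ h2 hηpos.le (by positivity))
    exact div_le_div_of_nonneg_left hA.le hq hlt.le
  have hspeed : ∀ s ∈ Icc 0 b, p s ≤ p₀ - c * s := fun s hs => by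
    have := le_add_mul_of_deriv_le h.deriv_p hacc hs
    rw [h.init_p] at this
    linarith
  have hle := le_add_mul_of_deriv_le (c := 0) (f := fun s => q s - (p₀ * s - c / 2 * s ^ 2))
    (fun s hs => (h.deriv_q s hs).sub
      (((hasDerivWithinAt_id s (Icc 0 b)).const_mul p₀).sub
        (((hasDerivWithinAt_id s (Icc 0 b)).pow 2).const_mul (c / 2))))
    (fun s hs => by have := hspeed s hs; simp; linarith) hmem
  have hq := h.pos b hmem
  simp only [h.init_q] at hle
  have e : c / 2 * b = |p₀| + 1 + c / 2 := by rw [hb]; field_simp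
  have : c / 2 * b ^ 2 = (|p₀| + 1 + c / 2) * b := by rw [← e]; ring
  nlinarith [le_abs_self p₀]

theorem not_of_lt_critSpeed (hA : 0 < A) (hB : 0 < B) (hp : p₀ < critSpeed A B) :
    ∃ b, ∀ q p, ¬ RadialMotion A B p₀ b q p := by
  have hs := critSpeed_sq hA hB
  have hn := Real.sqrt_nonneg (critSq A B)
  rcases lt_trichotomy (p₀ ^ 2) (critSq A B) with hlt | heq | hgt
  · refine not_subcritical_below hA ?_ hlt
    by_contra! hAB
    have : critSpeed A B ≤ 0 := by
      rcases hAB.lt_or_eq with h1 | rfl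
      · rw [critSpeed_of_gt h1]; linarith
      · rw [critSpeed_self]
    nlinarith
  · have hneg : p₀ < 0 := by nlinarith
    have hc : 0 < critSpeed A B := by nlinarith
    refine not_critical_inward hA ?_ hneg heq
    by_contra! hAB
    rcases hAB.lt_or_eq with h1 | rfl
    · rw [critSpeed_of_gt h1] at hc; linarith
    · rw [critSpeed_self] at hc; exact hc.false
  · refine not_supercritical_inward hA hB ?_ hgt
    by_contra! h0
    nlinarith

/-! ### The cases B ≤ 0 and A = 0 -/

theorem exp_le_of_nonpos (hA : 0 < A) (hB : B ≤ 0) (h : RadialMotion A B p₀ b q p) {t : ℝ}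
    (ht : t ∈ Icc 0 b) : Real.exp (-(p₀ ^ 2 - B) / (2 * A)) ≤ q t := by
  have hq := h.pos t ht
  rw [← Real.le_log_iff_exp_le hq, div_le_iff₀ (by positivity)]
  have h1 := h.energy ht
  have h2 : B / q t ^ 2 ≤ 0 := div_nonpos_of_nonpos_of_nonneg hB (by positivity)
  nlinarith [sq_nonneg (p t)]

/-- Without the A-term the energy law gives (q p)' = p² - B/q² = p₀² - B, a constant; integrate
twice. -/
theorem sq_eq_of_zero (h : RadialMotion 0 B p₀ b q p) {t : ℝ} (ht : t ∈ Icc 0 b) :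
    q t ^ 2 = 1 + 2 * p₀ * t + (p₀ ^ 2 - B) * t ^ 2 := by
  have h1 : ∀ s ∈ Icc 0 b, q s * p s = p₀ + (p₀ ^ 2 - B) * s := fun s hs => by
    have := eq_init_of_deriv_eq_zero (f := fun s => q s * p s - (p₀ ^ 2 - B) * s)
      (fun r hr => ((h.deriv_q r hr).mul (h.deriv_p r hr)).sub
        ((hasDerivWithinAt_id r (Icc 0 b)).const_mul (p₀ ^ 2 - B))) (fun r hr => ?_) hs
    · simp only [h.init_q, h.init_p] at this
      linarith
    · have hr0 := (h.pos r hr).ne'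
      have := h.energy hr
      have e : q r * (0 / q r - B / q r ^ 3) = -(B / q r ^ 2) := by field_simp; ring
      simp only [e]
      linarith
  have := eq_init_of_deriv_eq_zero
    (f := fun s => q s ^ 2 - (2 * p₀ * s + (p₀ ^ 2 - B) * s ^ 2))
    (fun r hr => ((h.deriv_q r hr).pow 2).sub
      (((hasDerivWithinAt_id r (Icc 0 b)).const_mul (2 * p₀)).add
        (((hasDerivWithinAt_id r (Icc 0 b)).pow 2).const_mul (p₀ ^ 2 - B)))) (fun r hr => ?_) ht
  · simp only [h.init_q] at this
    linarith
  · have := h1 r hr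
    simp
    linarith

theorem not_of_lt_sqrt (hB : 0 ≤ B) (hp : p₀ < √B) : ∃ b, ∀ q p, ¬ RadialMotion 0 B p₀ b q p := by
  -- The quadratic factors as (1 + (p₀ + √B)t)(1 - (√B - p₀)t), with a root at t = 1/(√B - p₀).
  have hc : 0 < √B - p₀ := by linarith
  refine ⟨1 / (√B - p₀), fun q p h => ?_⟩
  have hmem : 1 / (√B - p₀) ∈ Icc 0 (1 / (√B - p₀)) := ⟨by positivity, le_rfl⟩
  have h1 := h.sq_eq_of_zero hmem
  have h2 := h.pos _ hmem
  set τ := 1 / (√B - p₀)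
  have e : (√B - p₀) * τ = 1 := mul_one_div_cancel hc.ne'
  have : 1 + 2 * p₀ * τ + (p₀ ^ 2 - B) * τ ^ 2
      = (1 + (p₀ + √B) * τ) * (1 - (√B - p₀) * τ) := by
    linear_combination τ ^ 2 * Real.sq_sqrt hB
  rw [this, e] at h1
  nlinarith

theorem exists_lower_bound_of_zero (hp : B < 0 ∨ √B ≤ p₀) (T : ℝ) :
    ∃ δ > 0, ∀ b < T, ∀ q p, RadialMotion 0 B p₀ b q p → ∀ t ∈ Icc 0 b, δ ≤ q t := by
  by_cases hT : T < 0
  · exact ⟨1, one_pos, fun b hb q p _ t ht => absurd (ht.1.trans (ht.2.trans hb.le)) hT.not_ge⟩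
  obtain ⟨s, hs, hmin⟩ := (isCompact_Icc (a := 0) (b := T)).exists_isMinOn
    ⟨0, le_rfl, not_lt.1 hT⟩
    (f := fun t => 1 + 2 * p₀ * t + (p₀ ^ 2 - B) * t ^ 2) (by fun_prop)
  -- For B < 0 this is (1 + p₀s)² - Bs²; otherwise all coefficients are nonnegative.
  have hpos : 0 < 1 + 2 * p₀ * s + (p₀ ^ 2 - B) * s ^ 2 := by
    by_cases hB : B < 0
    · rcases hs.1.eq_or_lt with h0 | h0
      · rw [← h0]; norm_num
      · nlinarith [sq_nonneg (1 + p₀ * s), mul_pos (neg_pos.2 hB) (pow_pos h0 2)]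
    · have hB' := not_lt.1 hB
      have h1 := hp.resolve_left hB
      have h2 := Real.sqrt_nonneg B
      have h3 : B ≤ p₀ ^ 2 := by nlinarith [Real.sq_sqrt hB']
      have h4 := hs.1
      have h5 := mul_nonneg (h2.trans h1) h4
      have h6 := mul_nonneg (sub_nonneg.2 h3) (sq_nonneg s)
      linarith
  refine ⟨_, Real.sqrt_pos.2 hpos, fun b hb q p h t ht => ?_⟩
  rw [Real.sqrt_le_left (h.pos t ht).le, h.sq_eq_of_zero ht]
  exact hmin ⟨ht.1, ht.2.trans hb.le⟩

end RadialMotion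

end REP

namespace REP

open Set Filter Topology

theorem RadialMotion.mono {A B p₀ b b' : ℝ} {q p : ℝ → ℝ} (h : RadialMotion A B p₀ b q p)
    (hb : b' ≤ b) : RadialMotion A B p₀ b' q p where
  pos t ht := h.pos t ⟨ht.1, ht.2.trans hb⟩
  deriv_q t ht := (h.deriv_q t ⟨ht.1, ht.2.trans hb⟩).mono (Icc_subset_Icc_right hb)
  deriv_p t ht := (h.deriv_p t ⟨ht.1, ht.2.trans hb⟩).mono (Icc_subset_Icc_right hb)
  init_q := h.init_q
  init_p := h.init_p

/-! ### From the matrix system to the radial motion and back -/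

section Reduction

variable {k ρ₀ : ℝ} {M₀ : Matrix (Fin 2) (Fin 2) ℝ} {J : Set ℝ} {ρ : ℝ → ℝ}
  {M : ℝ → Matrix (Fin 2) (Fin 2) ℝ}

theorem d_eq (N : Matrix (Fin 2) (Fin 2) ℝ) : d N = N 0 0 + N 1 1 := Matrix.trace_fin_two N

theorem Γ_eq (N : Matrix (Fin 2) (Fin 2) ℝ) :
    Γ N = (N 0 0 - N 1 1) ^ 2 + 4 * (N 0 1 * N 1 0) := by
  rw [Γ, Matrix.trace_fin_two, Matrix.det_fin_two]; ring

/-- With `q = exp (∫ d / 2)`, the density and the traceless part of `M` are multiples of `q⁻²`, and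
`q` moves under the force `k ρ₀ / (2 q) - Γ₀ / (4 q ^ 3)`. -/
theorem IsSmoothSolution.exists_radialMotion (h : IsSmoothSolution k 0 ρ₀ M₀ J ρ M) {b : ℝ}
    (hb : 0 ≤ b) (hJ : Icc 0 b ⊆ J) :
    ∃ q p, RadialMotion (k * ρ₀ / 2) (Γ M₀ / 4) (d M₀ / 2) b q p ∧ ∀ t ∈ Icc 0 b,
      ρ t = ρ₀ / q t ^ 2 ∧ M t 0 1 = M₀ 0 1 / q t ^ 2 ∧ M t 1 0 = M₀ 1 0 / q t ^ 2 ∧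
      M t 0 0 - M t 1 1 = (M₀ 0 0 - M₀ 1 1) / q t ^ 2 ∧
      M t 0 0 + M t 1 1 = 2 * p t / q t := by
  have hM : ∀ t ∈ Icc 0 b, ∀ i j, HasDerivWithinAt (fun s => M s i j)
      (-(M t i 0 * M t 0 j + M t i 1 * M t 1 j) + k / 2 * ρ t * (1 : Matrix (Fin 2) (Fin 2) ℝ) i j)
      (Icc 0 b) t := fun t ht i j => by
    have := (h.eq_M t (hJ ht) i j).mono hJ
    simpa [pow_two, Matrix.mul_apply, Fin.sum_univ_two] using this
  have hρ : ∀ t ∈ Icc 0 b, HasDerivWithinAt ρ (-(ρ t * (M t 0 0 + M t 1 1))) (Icc 0 b) t :=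
    fun t ht => by
      have := (h.eq_ρ t (hJ ht)).mono hJ
      rwa [d_eq] at this
  have hcont : ContinuousOn (fun t => M t 0 0 + M t 1 1) (Icc 0 b) :=
    HasDerivWithinAt.continuousOn fun t ht => (hM t ht 0 0).add (hM t ht 1 1)
  -- A continuous extension of the trace to ℝ, so that its integral is differentiable at the
  -- endpoints too.
  set D : ℝ → ℝ := IccExtend hb ((Icc 0 b).domRestrict fun t => M t 0 0 + M t 1 1) with hD
  have hDc : Continuous D := hcont.domRestrict.Icc_extend'
  have hDe : ∀ t ∈ Icc 0 b, D t = M t 0 0 + M t 1 1 := fun t ht => by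
    rw [hD, IccExtend_of_mem _ _ ht]; rfl
  set q : ℝ → ℝ := fun t => Real.exp ((∫ s in (0 : ℝ)..t, D s) / 2) with hqdef
  have hqpos : ∀ t, 0 < q t := fun t => Real.exp_pos _
  have hq0 : q 0 = 1 := by simp [hqdef]
  have hq : ∀ t ∈ Icc 0 b,
      HasDerivWithinAt q (q t * ((M t 0 0 + M t 1 1) / 2)) (Icc 0 b) t := fun t ht => by
    rw [← hDe t ht]
    exact ((hDc.integral_hasStrictDerivAt 0 t).hasDerivAt.div_const 2).exp.hasDerivWithinAt
  have hconst : ∀ f f' : ℝ → ℝ, (∀ t ∈ Icc 0 b, HasDerivWithinAt f (f' t) (Icc 0 b) t) →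
      (∀ t ∈ Icc 0 b, f' t = -(f t * (M t 0 0 + M t 1 1))) → ∀ t ∈ Icc 0 b,
      f t = f 0 / q t ^ 2 := fun f f' hf hf' t ht => by
    have := eq_init_of_deriv_eq_zero (f := fun s => f s * q s ^ 2)
      (fun s hs => (hf s hs).mul ((hq s hs).pow 2))
      (fun s hs => by rw [hf' s hs]; simp; ring) ht
    simp only [hq0, one_pow, mul_one] at this
    rw [eq_div_iff (pow_ne_zero 2 (hqpos t).ne'), this]
  have eρ : ∀ t ∈ Icc 0 b, ρ t = ρ₀ / q t ^ 2 := fun t ht => by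
    rw [hconst ρ _ hρ (fun _ _ => rfl) t ht, h.init_ρ]
  have e01 : ∀ t ∈ Icc 0 b, M t 0 1 = M₀ 0 1 / q t ^ 2 := fun t ht => by
    rw [hconst (fun t => M t 0 1) _ (fun t ht => hM t ht 0 1)
      (fun _ _ => by simp; ring) t ht, h.init_M]
  have e10 : ∀ t ∈ Icc 0 b, M t 1 0 = M₀ 1 0 / q t ^ 2 := fun t ht => by
    rw [hconst (fun t => M t 1 0) _ (fun t ht => hM t ht 1 0)
      (fun _ _ => by simp; ring) t ht, h.init_M]
  have edf : ∀ t ∈ Icc 0 b, M t 0 0 - M t 1 1 = (M₀ 0 0 - M₀ 1 1) / q t ^ 2 := fun t ht => by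
    rw [hconst (fun t => M t 0 0 - M t 1 1) _ (fun t ht => (hM t ht 0 0).sub (hM t ht 1 1))
      (fun _ _ => by simp; ring) t ht, h.init_M]
  refine ⟨q, fun t => q t * ((M t 0 0 + M t 1 1) / 2), ⟨fun t _ => hqpos t, hq, fun t ht => ?_,
    hq0, by simp only [hq0, h.init_M, d_eq, one_mul]⟩,
    fun t ht => ⟨eρ t ht, e01 t ht, e10 t ht, edf t ht, ?_⟩⟩
  · have hd := (hq t ht).mul (((hM t ht 0 0).add (hM t ht 1 1)).div_const 2)
    refine hd.congr_deriv ?_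
    have hqn := (hqpos t).ne'
    simp only [Pi.add_apply, Matrix.one_apply_eq, Γ_eq]
    -- tr M² = (d² + Γ)/2, and Γ, quadratic in the traceless part, scales like q⁻⁴.
    have e : M t 0 0 * M t 0 0 + M t 0 1 * M t 1 0 + (M t 1 0 * M t 0 1 + M t 1 1 * M t 1 1)
        = ((M t 0 0 + M t 1 1) ^ 2 + ((M t 0 0 - M t 1 1) ^ 2 + 4 * (M t 0 1 * M t 1 0))) / 2 := by
      ring
    have e' : (M t 0 0 - M t 1 1) ^ 2 + 4 * (M t 0 1 * M t 1 0)
        = ((M₀ 0 0 - M₀ 1 1) ^ 2 + 4 * (M₀ 0 1 * M₀ 1 0)) / q t ^ 4 := by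
      rw [edf t ht, e01 t ht, e10 t ht]; field_simp
    rw [e'] at e
    have hlin : q t * ((M t 0 0 + M t 1 1) / 2) * ((M t 0 0 + M t 1 1) / 2) + q t *
        ((-(M t 0 0 * M t 0 0 + M t 0 1 * M t 1 0) + k / 2 * ρ t * 1 +
          (-(M t 1 0 * M t 0 1 + M t 1 1 * M t 1 1) + k / 2 * ρ t * 1)) / 2)
        = q t * ((M t 0 0 + M t 1 1) ^ 2 / 4 - (M t 0 0 * M t 0 0 + M t 0 1 * M t 1 0 +
          (M t 1 0 * M t 0 1 + M t 1 1 * M t 1 1)) / 2 + k / 2 * ρ t) := by ring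
    rw [hlin, e, eρ t ht]
    field_simp
    ring
  · have := (hqpos t).ne'
    field_simp

theorem not_smoothForAllTime
    (hbad : ∃ b, ∀ q p, ¬ RadialMotion (k * ρ₀ / 2) (Γ M₀ / 4) (d M₀ / 2) b q p) :
    ¬ SmoothForAllTime k 0 ρ₀ M₀ := by
  rintro ⟨ρ, M, h⟩
  obtain ⟨b, hb⟩ := hbad
  -- The given `b` may be negative.
  obtain ⟨q, p, hqp, -⟩ := h.exists_radialMotion (le_max_right b 0) fun t ht => ht.1
  exact hb q p (hqp.mono (le_max_left _ _))

/-- A lower bound on q bounds the force, hence p on [0, T), hence ρ and every entry of M. -/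
theorem not_blowsUpInFiniteTime
    (hgood : ∀ T : ℝ, ∃ δ > 0, ∀ b < T, ∀ q p,
      RadialMotion (k * ρ₀ / 2) (Γ M₀ / 4) (d M₀ / 2) b q p → ∀ t ∈ Icc 0 b, δ ≤ q t) :
    ¬ BlowsUpInFiniteTime k 0 ρ₀ M₀ := by
  rintro ⟨T, hT, ρ, M, h, hlim⟩
  obtain ⟨δ, hδ, hlow⟩ := hgood T
  set K := |k * ρ₀ / 2| / δ + |Γ M₀ / 4| / δ ^ 3 with hK
  have hK0 : 0 ≤ K := by positivity
  set P := |d M₀ / 2| + K * T with hP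
  have hP0 : 0 ≤ P := by positivity
  set C := |ρ₀| / δ ^ 2 + (2 * P / δ + |M₀ 0 0 - M₀ 1 1| / δ ^ 2 + |M₀ 0 1| / δ ^ 2 +
    |M₀ 1 0| / δ ^ 2) with hC
  have hbound : ∀ b ∈ Ioo 0 T, |ρ b| + ∑ i, ∑ j, |M b i j| ≤ C := by
    intro b hb
    obtain ⟨q, p, hqp, hform⟩ := h.exists_radialMotion hb.1.le
      fun t ht => ⟨ht.1, ht.2.trans_lt hb.2⟩
    have hmem : b ∈ Icc 0 b := ⟨hb.1.le, le_rfl⟩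
    have hq := hlow b hb.2 q p hqp
    have hacc : ∀ t ∈ Icc 0 b, |k * ρ₀ / 2 / q t - Γ M₀ / 4 / q t ^ 3| ≤ K := fun t ht => by
      have hqt := hqp.pos t ht
      refine (abs_sub _ _).trans ?_
      rw [abs_div, abs_div (Γ M₀ / 4), abs_of_pos hqt, abs_of_pos (pow_pos hqt 3)]
      exact add_le_add (div_le_div_of_nonneg_left (abs_nonneg _) hδ (hq t ht))
        (div_le_div_of_nonneg_left (abs_nonneg _) (pow_pos hδ 3)
          (pow_le_pow_left₀ hδ.le (hq t ht) 3))
    have hp : |p b| ≤ P := by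
      have h1 := le_add_mul_of_deriv_le hqp.deriv_p (fun t ht => (abs_le.1 (hacc t ht)).2) hmem
      have h2 := add_mul_le_of_le_deriv hqp.deriv_p (fun t ht => (abs_le.1 (hacc t ht)).1) hmem
      rw [hqp.init_p] at h1 h2
      have h3 := mul_le_mul_of_nonneg_left hb.2.le hK0
      rw [abs_le]
      constructor <;> linarith [abs_le.1 (le_refl |d M₀ / 2|)]
    obtain ⟨f1, f2, f3, f4, f5⟩ := hform b hmem
    have hqb := hqp.pos b hmem
    have hdiv : ∀ c : ℝ, |c / q b ^ 2| ≤ |c| / δ ^ 2 := fun c => by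
      rw [abs_div, abs_of_pos (pow_pos hqb 2)]
      exact div_le_div_of_nonneg_left (abs_nonneg _) (pow_pos hδ 2)
        (pow_le_pow_left₀ hδ.le (hq b hmem) 2)
    have h1 := hdiv ρ₀
    have h2 := hdiv (M₀ 0 1)
    have h3 := hdiv (M₀ 1 0)
    have h4 := hdiv (M₀ 0 0 - M₀ 1 1)
    rw [← f1] at h1
    rw [← f2] at h2
    rw [← f3] at h3
    rw [← f4] at h4
    have h5 : |M b 0 0 + M b 1 1| ≤ 2 * P / δ := by
      rw [f5, abs_div, abs_of_pos hqb, abs_mul, abs_two]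
      exact div_le_div₀ (by positivity) (by linarith) hδ (hq b hmem)
    have h6 : |M b 0 0| + |M b 1 1| ≤ |M b 0 0 + M b 1 1| + |M b 0 0 - M b 1 1| := by
      rcases abs_cases (M b 0 0) with ⟨e1, _⟩ | ⟨e1, _⟩ <;>
      rcases abs_cases (M b 1 1) with ⟨e2, _⟩ | ⟨e2, _⟩ <;> rw [e1, e2] <;>
      linarith [le_abs_self (M b 0 0 + M b 1 1), neg_abs_le (M b 0 0 + M b 1 1),
        le_abs_self (M b 0 0 - M b 1 1), neg_abs_le (M b 0 0 - M b 1 1)]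
    simp only [Fin.sum_univ_two]
    linarith
  obtain ⟨b, hb, hb'⟩ := ((hlim.eventually_gt_atTop C).and (Ioo_mem_nhdsLT hT)).exists
  exact (hbound b hb').not_gt hb

/-- The vector field of the system on `ℝ × (Fin 2 → Fin 2 → ℝ)`. -/
noncomputable def vectorField (k : ℝ) (x : ℝ × (Fin 2 → Fin 2 → ℝ)) : ℝ × (Fin 2 → Fin 2 → ℝ) :=
  (-(x.1 * (x.2 0 0 + x.2 1 1)), fun i j => -(x.2 i 0 * x.2 0 j + x.2 i 1 * x.2 1 j) +
    k / 2 * x.1 * (1 : Matrix (Fin 2) (Fin 2) ℝ) i j)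

theorem contDiff_vectorField (k : ℝ) : ContDiff ℝ ∞ (vectorField k) := by
  have hc : ∀ i j, ContDiff ℝ ∞ fun x : ℝ × (Fin 2 → Fin 2 → ℝ) => x.2 i j := fun i j => by
    fun_prop
  refine ContDiff.prodMk (contDiff_fst.mul ((hc 0 0).add (hc 1 1))).neg
    (contDiff_pi.2 fun i => contDiff_pi.2 fun j => ?_)
  exact ((((hc i 0).mul (hc 0 j)).add ((hc i 1).mul (hc 1 j))).neg).add
    ((contDiff_const.mul contDiff_fst).mul contDiff_const)

theorem isSmoothSolution_of_isIntegralCurveOn (hJ : UniqueDiffOn ℝ J)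
    {x : ℝ → ℝ × (Fin 2 → Fin 2 → ℝ)} (h0 : x 0 = (ρ₀, fun i j => M₀ i j))
    (hx : IsIntegralCurveOn x (fun _ => vectorField k) J) :
    IsSmoothSolution k 0 ρ₀ M₀ J (fun t => (x t).1) (fun t => Matrix.of (x t).2) := by
  have hs := contDiffOn_of_isIntegralCurveOn (contDiff_vectorField k) hJ hx
  have hs2 : ∀ i j, ContDiffOn ℝ ∞ (fun t => (x t).2 i j) J := fun i j =>
    contDiffOn_pi.1 (contDiffOn_pi.1 hs.snd i) j
  refine ⟨hs.fst, hs2, fun t ht i j => ?_, fun t ht => ?_, by simp [h0], by ext i j; simp [h0]⟩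
  · have h1 : HasDerivWithinAt (fun s => (x s).2) (vectorField k (x t)).2 J t :=
      (hx t ht).snd
    have h2 := hasDerivWithinAt_pi.1 (hasDerivWithinAt_pi.1 h1 i) j
    refine h2.congr_deriv ?_
    simp [vectorField, pow_two, Matrix.mul_apply, Fin.sum_univ_two]
  · have h1 : HasDerivWithinAt (fun s => (x s).1) (vectorField k (x t)).1 J t :=
      (hx t ht).fst
    refine h1.congr_deriv ?_
    simp [vectorField, d_eq]

theorem smoothForAllTime_or_blowsUp (k ρ₀ : ℝ) (M₀ : Matrix (Fin 2) (Fin 2) ℝ) :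
    SmoothForAllTime k 0 ρ₀ M₀ ∨ BlowsUpInFiniteTime k 0 ρ₀ M₀ := by
  rcases exists_global_or_blowup ((contDiff_vectorField k).of_le (by exact_mod_cast le_top))
    (ρ₀, fun i j => M₀ i j) with ⟨x, h0, hx⟩ | ⟨T, hT, x, h0, hx, hlim⟩
  · exact Or.inl ⟨_, _, isSmoothSolution_of_isIntegralCurveOn (uniqueDiffOn_Ici 0) h0 hx⟩
  · refine Or.inr ⟨T, hT, _, _, isSmoothSolution_of_isIntegralCurveOn (uniqueDiffOn_Ico 0 T) h0 hx,
      tendsto_atTop_mono (fun t => ?_) hlim⟩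
    have hnn : 0 ≤ ∑ i, ∑ j, |(x t).2 i j| := by positivity
    rw [Prod.norm_def]
    refine max_le ?_ ?_
    · rw [Real.norm_eq_abs]
      simpa using hnn
    · refine (pi_norm_le_iff_of_nonneg (by positivity)).2 fun i =>
        (pi_norm_le_iff_of_nonneg (by positivity)).2 fun j => ?_
      have h1 : |(x t).2 i j| ≤ ∑ j, |(x t).2 i j| :=
        Finset.single_le_sum (f := fun j => |(x t).2 i j|) (fun _ _ => abs_nonneg _)
          (Finset.mem_univ j)
      have h2 : ∑ j, |(x t).2 i j| ≤ ∑ i, ∑ j, |(x t).2 i j| :=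
        Finset.single_le_sum (f := fun i => ∑ j, |(x t).2 i j|) (fun _ _ => by positivity)
          (Finset.mem_univ i)
      rw [Real.norm_eq_abs]
      simp only [Matrix.of_apply]
      linarith [abs_nonneg (x t).1]

/-- Global existence and blow-up exhaust all cases, so excluding one yields the other. -/
theorem smooth_iff_and_blowsUp {Q : Prop}
    (hgood : Q → ∀ T : ℝ, ∃ δ > 0, ∀ b < T, ∀ q p,
      RadialMotion (k * ρ₀ / 2) (Γ M₀ / 4) (d M₀ / 2) b q p → ∀ t ∈ Icc 0 b, δ ≤ q t)
    (hbad : ¬ Q → ∃ b, ∀ q p, ¬ RadialMotion (k * ρ₀ / 2) (Γ M₀ / 4) (d M₀ / 2) b q p) :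
    (SmoothForAllTime k 0 ρ₀ M₀ ↔ Q) ∧ (¬ Q → BlowsUpInFiniteTime k 0 ρ₀ M₀) := by
  have hor := smoothForAllTime_or_blowsUp k ρ₀ M₀
  refine ⟨⟨fun h => ?_, fun h => hor.resolve_right (not_blowsUpInFiniteTime (hgood h))⟩,
    fun h => hor.resolve_left (not_smoothForAllTime (hbad h))⟩
  by_contra hQ
  exact not_smoothForAllTime (hbad hQ) h

end Reduction

/-! ### Translating the thresholds and concluding -/

theorem g_eq {k ρ Γ : ℝ} : g k ρ Γ = 2 * critSpeed (k * ρ / 2) (Γ / 4) := by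
  have e1 : k * ρ / 2 / (Γ / 4) = 2 * k * ρ / Γ := by
    rw [div_div_eq_mul_div, div_mul_eq_mul_div, div_div, ← mul_div_mul_left _ (2 * Γ) two_ne_zero,
      mul_comm (2 : ℝ) (k * ρ * 4)]
    rw [show k * ρ * 4 * 2 = 4 * (2 * k * ρ) by ring, show 2 * (2 * Γ) = 4 * Γ by ring,
      mul_div_mul_left _ _ (by norm_num)]
  have e2 : Real.sign (Γ / 4 - k * ρ / 2) = Real.sign (Γ - 2 * k * ρ) := by
    rcases lt_trichotomy (Γ - 2 * k * ρ) 0 with h | h | h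
    · rw [Real.sign_of_neg h, Real.sign_of_neg (by linarith)]
    · rw [h, show Γ / 4 - k * ρ / 2 = 0 by linarith]
    · rw [Real.sign_of_pos h, Real.sign_of_pos (by linarith)]
  have e3 : Γ - 2 * k * ρ + 2 * k * ρ * Real.log (2 * k * ρ / Γ)
      = 2 ^ 2 * critSq (k * ρ / 2) (Γ / 4) := by
    rw [critSq, e1]; ring
  rw [g, critSpeed, e2, e3, Real.sqrt_mul (by positivity), Real.sqrt_sq (by positivity)]
  ring

theorem sqrt_div_four (x : ℝ) : √(x / 4) = √x / 2 := by
  rw [Real.sqrt_div' _ (by norm_num), show (4 : ℝ) = 2 ^ 2 by norm_num, Real.sqrt_sq (by positivity)]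

end REP

theorem theorem1p1 (k : ℝ) (hk : 0 < k) (ρ₀ : ℝ) (hρ₀ : 0 ≤ ρ₀)
    (M₀ : Matrix (Fin 2) (Fin 2) ℝ) :
    ((ρ₀ = 0 → REP.Γ M₀ = 0) →
      (REP.SmoothForAllTime k 0 ρ₀ M₀ ↔
        (ρ₀, REP.d M₀, REP.Γ M₀) ∈ REP.S₁ ∪ REP.S₂ k) ∧
      ((ρ₀, REP.d M₀, REP.Γ M₀) ∉ REP.S₁ ∪ REP.S₂ k →
        REP.BlowsUpInFiniteTime k 0 ρ₀ M₀)) ∧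
    (ρ₀ = 0 →
      (REP.SmoothForAllTime k 0 ρ₀ M₀ ↔
        REP.Γ M₀ < 0 ∨ Real.sqrt (REP.Γ M₀) ≤ REP.d M₀) ∧
      (¬ (REP.Γ M₀ < 0 ∨ Real.sqrt (REP.Γ M₀) ≤ REP.d M₀) →
        REP.BlowsUpInFiniteTime k 0 ρ₀ M₀)) := by
  open REP in
  have hmem : (ρ₀, d M₀, Γ M₀) ∈ S₁ ∪ S₂ k ↔
      (Γ M₀ ≤ 0 ∧ (ρ₀ = 0 → 0 ≤ d M₀)) ∨ (0 < ρ₀ ∧ 0 < Γ M₀ ∧ g k ρ₀ (Γ M₀) ≤ d M₀) := by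
    constructor
    · rintro (⟨_, _, _, he, h1, h2, h3⟩ | ⟨_, _, _, he, h1, h2, h3⟩)
      · obtain ⟨rfl, rfl, rfl⟩ := by simpa only [Prod.mk.injEq] using he
        exact Or.inl ⟨h2, h3⟩
      · obtain ⟨rfl, rfl, rfl⟩ := by simpa only [Prod.mk.injEq] using he
        exact Or.inr ⟨h1, h2, h3⟩
    · rintro (⟨h2, h3⟩ | ⟨h1, h2, h3⟩)
      · exact Or.inl ⟨_, _, _, rfl, hρ₀, h2, h3⟩
      · exact Or.inr ⟨_, _, _, rfl, h1, h2, h3⟩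
  have hzero : ρ₀ = 0 → (SmoothForAllTime k 0 ρ₀ M₀ ↔ Γ M₀ < 0 ∨ √(Γ M₀) ≤ d M₀) ∧
      (¬ (Γ M₀ < 0 ∨ √(Γ M₀) ≤ d M₀) → BlowsUpInFiniteTime k 0 ρ₀ M₀) := by
    rintro rfl
    apply smooth_iff_and_blowsUp <;> rw [mul_zero, zero_div]
    · intro h T
      refine RadialMotion.exists_lower_bound_of_zero (h.imp (fun h => by linarith) fun h => ?_) T
      rw [sqrt_div_four]
      linarith
    · intro h
      push Not at h
      refine RadialMotion.not_of_lt_sqrt (by linarith) ?_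
      rw [sqrt_div_four]
      linarith
  refine ⟨fun h0 => ?_, hzero⟩
  rcases hρ₀.eq_or_lt with rfl | hpos
  · have hΓ := h0 rfl
    have := hzero rfl
    -- With ρ₀ = Γ₀ = 0 both sides say d₀ ≥ 0.
    have e : (0, d M₀, Γ M₀) ∈ S₁ ∪ S₂ k ↔ Γ M₀ < 0 ∨ √(Γ M₀) ≤ d M₀ := by
      rw [hmem, hΓ]
      simp
    rwa [e]
  · have hA : 0 < k * ρ₀ / 2 := by positivity
    apply smooth_iff_and_blowsUp
    · intro h T
      rcases hmem.1 h with ⟨hΓ, -⟩ | ⟨-, hΓ, hd⟩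
      · exact ⟨_, Real.exp_pos _, fun b _ q p hqp t ht => hqp.exp_le_of_nonpos hA (by linarith) ht⟩
      · have hB : 0 < Γ M₀ / 4 := by positivity
        refine ⟨_, lt_min one_pos (Real.sqrt_pos.2 (div_pos hB hA)), fun b _ q p hqp t ht =>
          hqp.min_le_of_critSpeed_le hA hB ?_ ht⟩
        rw [g_eq] at hd
        linarith
    · intro h
      rw [hmem] at h
      push Not at h
      have hΓ : 0 < Γ M₀ := by
        by_contra! hΓ
        exact hpos.ne' (h.1 hΓ).1
      refine RadialMotion.not_of_lt_critSpeed hA (by positivity) ?_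
      have := h.2 hpos hΓ
      rw [g_eq] at this
      linarith
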